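/- Let $\mathbb F$ be a floating-point format with radix $b\ge 2$, precision $p\ge 1$ and exponent range $e_{\min}\le e_{\max}$, i.e. $\mathbb F=\{m\,b^{e} : m,e\in\mathbb Z,\ |m|<b^{p},\ e_{\min}\le e\le e_{\max}\}$, with unit roundoff $\kappa=\tfrac12 b^{1-p}$ and underflow unit $\eta=\tfrac12 b^{e_{\min}}$ (for IEEE 754 binary64: $\kappa=2^{-53}$, $\eta=2^{-1075}$). Let the arithmetic operations and the square root be evaluated in $\mathbb F$ with rounding to nearest, with any tie-breaking rule. Let $\widetilde C\in\mathbb F^{D\times D}$ be symmetric. Suppose that $(2D+2)\kappa<1$, that $$\frac{(D+1)D\,\kappa}{1-(2D+2)\kappa}+4(D+1)\eta\le\frac12 ,$$ and that $$\beta=\frac{(D+1)\kappa}{1-(2D+2)\kappa}\,\mathrm{tr}(\widetilde C)+4(D+1)\Bigl(2(D+2)+\max_i \widetilde C_{ii}\Bigr)\eta>0 .$$ If the Cholesky algorithm executed in floating-point arithmetic succeeds on $\widetilde C$, that is, if the evaluation in $\mathbb F$ of $$R_{ij}=\Bigl(\widetilde C_{ij}-\sum_{k<i}R_{ki}R_{kj}\Bigr)\Big/R_{ii}\quad(i<j),\qquad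 R_{jj}=\sqrt{\widetilde C_{jj}-\sum_{k<j}R_{kj}^2}$$ (each sum being subtracted term by term from left to right) runs to completion without the square root of a negative number, a division by zero or an overflow, then $\widetilde C+2\beta I\succeq 0$, i.e. this matrix is symmetric with nonnegative eigenvalues. -/

import Mathlib

/-- A floating-point format with subnormal numbers. The finite numbers are `m * radix ^ e` with an
integer significand `|m| < radix ^ prec` and an integer exponent `eMin ≤ e ≤ eMax`; for instance
IEEE 754 binary64 has `radix = 2`, `prec = 53`, `eMin = -1074`, `eMax = 971`. -/
structure FloatFormat where
  radix : ℕ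
  prec : ℕ
  eMin : ℤ
  eMax : ℤ
  two_le_radix : 2 ≤ radix
  one_le_prec : 1 ≤ prec
  eMin_le_eMax : eMin ≤ eMax

namespace FloatFormat

/-- The finite floating-point numbers of the format. -/
def numbers (F : FloatFormat) : Set ℝ :=
  {x | ∃ m e : ℤ, |m| < (F.radix : ℤ) ^ F.prec ∧ F.eMin ≤ e ∧ e ≤ F.eMax ∧
    x = (m : ℝ) * (F.radix : ℝ) ^ e}

/-- The numbers of the same precision and least exponent, without an upper bound on the exponent.
As in IEEE 754, results are first rounded as if the exponent were unbounded above, and an operation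
overflows when the rounded result is not a number of the format. -/
def grid (F : FloatFormat) : Set ℝ :=
  {x | ∃ m e : ℤ, |m| < (F.radix : ℤ) ^ F.prec ∧ F.eMin ≤ e ∧ x = (m : ℝ) * (F.radix : ℝ) ^ e}

/-- The unit roundoff (half the relative spacing); `2 ^ (-53)` for binary64. -/
noncomputable def unitRoundoff (F : FloatFormat) : ℝ :=
  (F.radix : ℝ) ^ (1 - (F.prec : ℤ)) / 2

/-- The underflow unit (half the least positive subnormal number); `2 ^ (-1075)` for binary64. -/
noncomputable def underflowUnit (F : FloatFormat) : ℝ :=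
  (F.radix : ℝ) ^ F.eMin / 2

/-- `fl` rounds every real number to a nearest number; ties may be broken in any way. -/
def IsRoundToNearest (F : FloatFormat) (fl : ℝ → ℝ) : Prop :=
  ∀ x : ℝ, fl x ∈ F.grid ∧ ∀ y ∈ F.grid, |x - fl x| ≤ |x - y|

open Classical in
/-- The floating-point result of an operation with exact result `x`; `none` is overflow. -/
noncomputable def round (F : FloatFormat) (fl : ℝ → ℝ) (x : ℝ) : Option ℝ :=
  if fl x ∈ F.numbers then some (fl x) else none

noncomputable def sub (F : FloatFormat) (fl : ℝ → ℝ) (x y : ℝ) : Option ℝ :=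
  F.round fl (x - y)

noncomputable def mul (F : FloatFormat) (fl : ℝ → ℝ) (x y : ℝ) : Option ℝ :=
  F.round fl (x * y)

open Classical in
/-- Floating-point division; it fails if the divisor is zero. -/
noncomputable def div (F : FloatFormat) (fl : ℝ → ℝ) (x y : ℝ) : Option ℝ :=
  if y = 0 then none else F.round fl (x / y)

open Classical in
/-- Floating-point square root; it fails if the argument is negative. -/
noncomputable def sqrt (F : FloatFormat) (fl : ℝ → ℝ) (x : ℝ) : Option ℝ :=
  if x < 0 then none else F.round fl (Real.sqrt x)

/-- The floating-point evaluation, from left to right, of `s - x₀ * y₀ - x₁ * y₁ - ⋯`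
with `n` products. -/
noncomputable def subDot (F : FloatFormat) (fl : ℝ → ℝ) (s : ℝ) :
    (n : ℕ) → (Fin n → Option ℝ) → (Fin n → Option ℝ) → Option ℝ
  | 0, _, _ => some s
  | n + 1, x, y => do
    let t ← F.subDot fl s n (fun k => x k.castSucc) (fun k => y k.castSucc)
    let a ← x (Fin.last n)
    let b ← y (Fin.last n)
    let p ← F.mul fl a b
    F.sub fl t p

/-- The entry `R i j`, `i ≤ j`, of the upper triangular factor that the Cholesky algorithm computes
from the upper triangle of `C`, every operation being a floating-point operation:
`R i j = (C i j - ∑ k < i, R k i * R k j) / R i i` for `i < j`, and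
`R j j = √(C j j - ∑ k < j, R k j * R k j)`.
The value is `none` if an operation on which the entry depends fails. -/
noncomputable def choleskyEntry (F : FloatFormat) (fl : ℝ → ℝ) {D : ℕ}
    (C : Matrix (Fin D) (Fin D) ℝ) (i j : Fin D) : Option ℝ := do
  let s ← F.subDot fl (C i j) i.val
    (fun k => F.choleskyEntry fl C ⟨k.val, k.isLt.trans i.isLt⟩ i)
    (fun k => F.choleskyEntry fl C ⟨k.val, k.isLt.trans i.isLt⟩ j)
  if i < j then do
    let d ← F.choleskyEntry fl C i i
    F.div fl s d
  else
    F.sqrt fl s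
termination_by (i.val, j.val - i.val)
decreasing_by
  · exact Prod.Lex.left _ _ k.isLt
  · exact Prod.Lex.left _ _ k.isLt
  · apply Prod.Lex.right
    omega

/-- The floating-point Cholesky algorithm succeeds on `C`: it runs to completion, that is, without
a square root of a negative number, a division by zero, or an overflow. -/
def CholeskySucceeds (F : FloatFormat) (fl : ℝ → ℝ) {D : ℕ}
    (C : Matrix (Fin D) (Fin D) ℝ) : Prop :=
  ∀ i j : Fin D, i ≤ j → (F.choleskyEntry fl C i j).isSome

end FloatFormat

namespace FloatFormat

/-! Backward error analysis: the computed factor R is an almost exact Cholesky factor, |C - RᵀR| ≤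
γ|R|ᵀ|R| + w entrywise, with γ = (1-κ)^(-(D+1)) - 1 and w of order η (`cholesky_backward_error`). As
RᵀR ⪰ 0, Cauchy–Schwarz bounds the negative part of C by γ‖R‖_F² + Dw
(`posSemidef_add_smul_one_of_abs_sub_gram_le`). The diagonal of the same estimate gives (1-γ)‖R‖_F²
≤ tr C + Dw, so the loss is about γ/(1-γ) · tr C. Bernoulli's inequality bounds γ/(1-γ) by the
coefficient of the trace in β; the η term of β absorbs the underflow. -/

theorem radix_pos (F : FloatFormat) : (0 : ℝ) < F.radix := by
  have := F.two_le_radix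
  positivity

theorem radix_ne_zero (F : FloatFormat) : (F.radix : ℝ) ≠ 0 := F.radix_pos.ne'

theorem one_lt_radix (F : FloatFormat) : (1 : ℝ) < F.radix := by
  exact_mod_cast F.two_le_radix

theorem unitRoundoff_pos (F : FloatFormat) : 0 < F.unitRoundoff :=
  div_pos (zpow_pos F.radix_pos _) two_pos

theorem underflowUnit_pos (F : FloatFormat) : 0 < F.underflowUnit :=
  div_pos (zpow_pos F.radix_pos _) two_pos

/-! ### Grid points and rounding errors -/

theorem zero_mem_grid (F : FloatFormat) : (0 : ℝ) ∈ F.grid := by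
  refine ⟨0, F.eMin, ?_, le_rfl, by simp⟩
  have := F.two_le_radix
  simp only [abs_zero]
  positivity

theorem numbers_subset_grid (F : FloatFormat) : F.numbers ⊆ F.grid := by
  rintro x ⟨m, e, hm, he, -, rfl⟩
  exact ⟨m, e, hm, he, rfl⟩

/-- Integer multiples of `radix ^ e` with significand at most `radix ^ prec` lie on the grid. -/
theorem int_mul_zpow_mem_grid (F : FloatFormat) {m e : ℤ} (he : F.eMin ≤ e)
    (hm : |m| ≤ (F.radix : ℤ) ^ F.prec) : (m : ℝ) * (F.radix : ℝ) ^ e ∈ F.grid := by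
  rcases hm.lt_or_eq with h | h
  · exact ⟨m, e, h, he, rfl⟩
  -- The significand ±b^p is too large by one; it carries to ±b^(p-1) at exponent e + 1, which the
  -- grid always allows.
  · have hb : (1 : ℤ) < F.radix := by exact_mod_cast F.two_le_radix
    obtain ⟨q, hq⟩ := Nat.exists_eq_add_of_le' F.one_le_prec
    have hlt : (F.radix : ℤ) ^ q < (F.radix : ℤ) ^ F.prec :=
      pow_lt_pow_right₀ hb (by omega)
    have hpow : (F.radix : ℤ) ^ F.prec = (F.radix : ℤ) ^ q * F.radix := by
      rw [hq, pow_succ]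
    have hq0 : (0 : ℤ) ≤ (F.radix : ℤ) ^ q := by positivity
    have hz : (F.radix : ℝ) ^ (e + 1) = (F.radix : ℝ) ^ e * F.radix :=
      zpow_add_one₀ F.radix_ne_zero e
    rcases abs_choice m with hc | hc
    · refine ⟨(F.radix : ℤ) ^ q, e + 1, by rwa [abs_of_nonneg hq0], by omega, ?_⟩
      rw [← hc, h, hpow, hz]
      push_cast
      ring
    · refine ⟨-(F.radix : ℤ) ^ q, e + 1, by rwa [abs_neg, abs_of_nonneg hq0], by omega, ?_⟩
      have : m = -((F.radix : ℤ) ^ q * F.radix) := by rw [← hpow, ← h, hc, neg_neg]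
      rw [this, hz]
      push_cast
      ring

/-- Round x / b^e to the nearest integer; since b^p is itself an integer, the rounded significand
does not exceed it. -/
theorem exists_grid_near (F : FloatFormat) {e : ℤ} (he : F.eMin ≤ e) {x : ℝ}
    (hx : |x| ≤ (F.radix : ℝ) ^ (e + F.prec)) :
    ∃ y ∈ F.grid, |x - y| ≤ (F.radix : ℝ) ^ e / 2 := by
  have hz : 0 < (F.radix : ℝ) ^ e := zpow_pos F.radix_pos e
  set u := x / (F.radix : ℝ) ^ e with hu
  have hxu : x = u * (F.radix : ℝ) ^ e := by rw [hu]; field_simp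
  have hu' : |u| ≤ (F.radix : ℝ) ^ F.prec := by
    rw [hu, abs_div, abs_of_pos hz, div_le_iff₀ hz, ← zpow_natCast,
      ← zpow_add₀ F.radix_ne_zero, add_comm]
    exact hx
  refine ⟨(_root_.round u : ℝ) * (F.radix : ℝ) ^ e, F.int_mul_zpow_mem_grid he ?_, ?_⟩
  · have h1 := abs_sub_round u
    obtain ⟨h2, h3⟩ := abs_le.1 h1
    obtain ⟨h4, h5⟩ := abs_le.1 hu'
    rw [abs_le]
    constructor
    · have : ((-(F.radix : ℤ) ^ F.prec - 1 : ℤ) : ℝ) < (_root_.round u : ℤ) := by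
        push_cast; linarith
      have := Int.cast_lt.1 this
      omega
    · have : ((_root_.round u : ℤ) : ℝ) < (((F.radix : ℤ) ^ F.prec + 1 : ℤ) : ℝ) := by
        push_cast; linarith
      have := Int.cast_lt.1 this
      omega
  · have : x - (_root_.round u : ℝ) * (F.radix : ℝ) ^ e
        = (u - _root_.round u) * (F.radix : ℝ) ^ e := by
      rw [sub_mul, ← hxu]
    rw [this, abs_mul, abs_of_pos hz]
    nlinarith [abs_sub_round u]

/-- Above the subnormal range a grid point lies within relative distance `unitRoundoff`. -/
theorem exists_grid_near_rel (F : FloatFormat) {x : ℝ}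
    (hx : (F.radix : ℝ) ^ (F.eMin + F.prec) ≤ |x|) :
    ∃ y ∈ F.grid, |x - y| ≤ F.unitRoundoff * |x| := by
  have hx0 : 0 < |x| := (zpow_pos F.radix_pos _).trans_le hx
  -- With b^n ≤ |x| < b^(n+1), the spacing b^(n+1-p) is available, and half of it is κb^n ≤ κ|x|.
  obtain ⟨n, hn1, hn2⟩ := exists_mem_Ico_zpow hx0 F.one_lt_radix
  have hn : F.eMin + F.prec < n + 1 := (zpow_lt_zpow_iff_right₀ F.one_lt_radix).1 (hx.trans_lt hn2)
  obtain ⟨y, hy, hxy⟩ := F.exists_grid_near (e := n + 1 - F.prec) (x := x) (by omega)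
    (by rw [sub_add_cancel]; exact hn2.le)
  refine ⟨y, hy, hxy.trans ?_⟩
  have : (F.radix : ℝ) ^ (n + 1 - F.prec) / 2 = F.unitRoundoff * (F.radix : ℝ) ^ n := by
    rw [unitRoundoff, div_mul_eq_mul_div, ← zpow_add₀ F.radix_ne_zero]
    congr 2
    ring
  rw [this]
  exact mul_le_mul_of_nonneg_left hn1 F.unitRoundoff_pos.le

theorem exists_int_mul_of_mem_grid (F : FloatFormat) {x : ℝ} (hx : x ∈ F.grid) :
    ∃ m : ℤ, x = m * (F.radix : ℝ) ^ F.eMin := by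
  obtain ⟨m, e, -, he, rfl⟩ := hx
  obtain ⟨k, rfl⟩ := Int.le.dest he
  refine ⟨m * (F.radix : ℤ) ^ k, ?_⟩
  rw [zpow_add₀ F.radix_ne_zero, zpow_natCast]
  push_cast
  ring

variable {F : FloatFormat} {fl : ℝ → ℝ}

theorem IsRoundToNearest.eq_of_mem_grid (hfl : F.IsRoundToNearest fl) {x : ℝ} (hx : x ∈ F.grid) :
    fl x = x := by
  have := (hfl x).2 x hx
  rw [sub_self, abs_zero] at this
  exact (sub_eq_zero.1 (abs_nonpos_iff.1 this)).symm

theorem IsRoundToNearest.le_of_le (hfl : F.IsRoundToNearest fl) {x y : ℝ} (hy : y ∈ F.grid)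
    (hxy : x ≤ y) : fl x ≤ y := by
  by_contra! h
  have := (hfl x).2 y hy
  rw [abs_of_nonpos (by linarith), abs_of_nonpos (by linarith)] at this
  linarith

theorem IsRoundToNearest.le_of_ge (hfl : F.IsRoundToNearest fl) {x y : ℝ} (hy : y ∈ F.grid)
    (hxy : y ≤ x) : y ≤ fl x := by
  by_contra! h
  have := (hfl x).2 y hy
  rw [abs_of_nonneg (by linarith), abs_of_nonneg (by linarith)] at this
  linarith

theorem exists_eq_mul_one_add {κ x y : ℝ} (hκ : 0 ≤ κ) (h : |x - y| ≤ κ * |x|) :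
    ∃ δ, |δ| ≤ κ ∧ y = x * (1 + δ) := by
  rcases eq_or_ne x 0 with rfl | hx
  · refine ⟨0, by simpa, ?_⟩
    simp only [abs_zero, mul_zero, zero_sub, abs_neg] at h
    simp [abs_nonpos_iff.1 h]
  · refine ⟨(y - x) / x, ?_, by field_simp; ring⟩
    rw [abs_div, div_le_iff₀ (abs_pos.2 hx), abs_sub_comm]
    exact h

/-- The standard model of rounding with gradual underflow. -/
theorem IsRoundToNearest.exists_error (hfl : F.IsRoundToNearest fl) (x : ℝ) :
    ∃ δ ε, |δ| ≤ F.unitRoundoff ∧ |ε| ≤ F.underflowUnit ∧ fl x = x * (1 + δ) + ε := by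
  -- Below this threshold the spacing b^eMin gives a purely absolute error; above it the error is
  -- purely relative.
  rcases le_total |x| ((F.radix : ℝ) ^ (F.eMin + F.prec)) with h | h
  · obtain ⟨y, hy, hxy⟩ := F.exists_grid_near le_rfl h
    refine ⟨0, fl x - x, by simpa using F.unitRoundoff_pos.le, ?_, by ring⟩
    rw [abs_sub_comm]
    exact ((hfl x).2 y hy).trans hxy
  · obtain ⟨y, hy, hxy⟩ := F.exists_grid_near_rel h
    obtain ⟨δ, hδ, h'⟩ := exists_eq_mul_one_add F.unitRoundoff_pos.le
      (((hfl x).2 y hy).trans hxy)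
    exact ⟨δ, 0, hδ, by simpa using F.underflowUnit_pos.le, by rw [h', add_zero]⟩

/-- Subtraction of grid numbers does not underflow. -/
theorem IsRoundToNearest.exists_error_sub (hfl : F.IsRoundToNearest fl) {x y : ℝ}
    (hx : x ∈ F.grid) (hy : y ∈ F.grid) :
    ∃ δ, |δ| ≤ F.unitRoundoff ∧ fl (x - y) = (x - y) * (1 + δ) := by
  rcases le_total |x - y| ((F.radix : ℝ) ^ (F.eMin + F.prec)) with h | h
  -- Both operands are multiples of b^eMin, so a small difference lies on the grid and is computed
  -- exactly.
  · obtain ⟨m, hm⟩ := F.exists_int_mul_of_mem_grid hx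
    obtain ⟨n, hn⟩ := F.exists_int_mul_of_mem_grid hy
    have hmn : x - y = ((m - n : ℤ) : ℝ) * (F.radix : ℝ) ^ F.eMin := by
      rw [hm, hn]; push_cast; ring
    have hmem : x - y ∈ F.grid := by
      have hz : 0 < (F.radix : ℝ) ^ F.eMin := zpow_pos F.radix_pos _
      rw [hmn, abs_mul, abs_of_pos hz, zpow_add₀ F.radix_ne_zero, zpow_natCast, mul_comm,
        mul_le_mul_iff_right₀ hz] at h
      rw [hmn]
      exact F.int_mul_zpow_mem_grid le_rfl (by exact_mod_cast h)
    exact ⟨0, by simpa using F.unitRoundoff_pos.le, by rw [hfl.eq_of_mem_grid hmem]; ring⟩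
  · obtain ⟨z, hz, hxz⟩ := F.exists_grid_near_rel h
    exact exists_eq_mul_one_add F.unitRoundoff_pos.le (((hfl _).2 z hz).trans hxz)

theorem round_eq_some {x y : ℝ} (h : F.round fl x = some y) : y = fl x := by
  unfold round at h
  split_ifs at h
  exact (Option.some.inj h).symm

/-! ### Accumulated relative errors -/

/-- `θ` is within the range of products of `n` factors `(1 + δ) ^ (±1)` with `|δ| ≤ κ`. -/
def IsErrorFactor (κ : ℝ) (n : ℕ) (θ : ℝ) : Prop :=
  (1 - κ) ^ n ≤ θ ∧ θ ≤ ((1 - κ) ^ n)⁻¹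

theorem IsErrorFactor.mul {κ θ φ : ℝ} {m n : ℕ} (hκ : κ < 1) (hθ : IsErrorFactor κ m θ)
    (hφ : IsErrorFactor κ n φ) : IsErrorFactor κ (m + n) (θ * φ) := by
  have hm : 0 < (1 - κ) ^ m := pow_pos (by linarith) m
  have hn : 0 < (1 - κ) ^ n := pow_pos (by linarith) n
  rw [IsErrorFactor, pow_add, mul_inv]
  exact ⟨mul_le_mul hθ.1 hφ.1 hn.le (hm.le.trans hθ.1),
    mul_le_mul hθ.2 hφ.2 (hn.le.trans hφ.1) (inv_pos.2 hm).le⟩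

theorem isErrorFactor_zero (κ : ℝ) : IsErrorFactor κ 0 1 := by simp [IsErrorFactor]

theorem isErrorFactor_one_add {κ δ : ℝ} (hκ : κ < 1) (hδ : |δ| ≤ κ) :
    IsErrorFactor κ 1 (1 + δ) := by
  obtain ⟨h1, h2⟩ := abs_le.1 hδ
  rw [IsErrorFactor, pow_one]
  refine ⟨by linarith, ?_⟩
  rw [← one_div, le_div_iff₀ (by linarith)]
  nlinarith

theorem IsErrorFactor.inv {κ θ : ℝ} {n : ℕ} (hκ : κ < 1) (hθ : IsErrorFactor κ n θ) :
    IsErrorFactor κ n θ⁻¹ := by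
  have hn : 0 < (1 - κ) ^ n := pow_pos (by linarith) n
  refine ⟨?_, inv_anti₀ hn hθ.1⟩
  rw [le_inv_comm₀ hn (hn.trans_le hθ.1)]
  exact hθ.2

theorem IsErrorFactor.pos {κ θ : ℝ} {n : ℕ} (hκ : κ < 1) (hθ : IsErrorFactor κ n θ) : 0 < θ :=
  (pow_pos (by linarith) n).trans_le hθ.1

theorem IsErrorFactor.mono {κ θ : ℝ} {m n : ℕ} (hκ0 : 0 ≤ κ) (hκ : κ < 1) (hmn : m ≤ n)
    (hθ : IsErrorFactor κ m θ) : IsErrorFactor κ n θ := by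
  have h : (1 - κ) ^ n ≤ (1 - κ) ^ m := pow_le_pow_of_le_one (by linarith) (by linarith) hmn
  exact ⟨h.trans hθ.1, hθ.2.trans (inv_anti₀ (pow_pos (by linarith) n) h)⟩

/-- By z + 1/z ≥ 2, the upper end of the interval is at least as far from 1 as the lower end. -/
theorem IsErrorFactor.abs_sub_one_le {κ θ : ℝ} {n : ℕ} (hκ : κ < 1) (hθ : IsErrorFactor κ n θ) :
    |θ - 1| ≤ ((1 - κ) ^ n)⁻¹ - 1 := by
  have hn : 0 < (1 - κ) ^ n := pow_pos (by linarith) n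
  have : 2 ≤ (1 - κ) ^ n + ((1 - κ) ^ n)⁻¹ := by
    have h := mul_inv_cancel₀ hn.ne'
    nlinarith [sq_nonneg ((1 - κ) ^ n - 1), inv_pos.2 hn,
      mul_nonneg (inv_pos.2 hn).le (sq_nonneg ((1 - κ) ^ n - 1))]
  rw [abs_le]
  constructor <;> linarith [hθ.1, hθ.2]

/-! ### Backward error of the inner product -/

/-- Each rounded subtraction is solved for its left operand. The subtraction errors thus collect in
the factor φ on the result t and s stays unperturbed; underflow comes only from the products. -/
theorem subDot_backward_error (hfl : F.IsRoundToNearest fl) (hκ : F.unitRoundoff < 1) {s : ℝ}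
    (hs : s ∈ F.grid) (n : ℕ) (x y : Fin n → Option ℝ) (a b : Fin n → ℝ)
    (hx : ∀ k, x k = some (a k)) (hy : ∀ k, y k = some (b k)) {t : ℝ}
    (h : F.subDot fl s n x y = some t) :
    t ∈ F.grid ∧ ∃ φ, IsErrorFactor F.unitRoundoff n φ ∧
      |s - ∑ k, a k * b k - φ * t| ≤ (((1 - F.unitRoundoff) ^ n)⁻¹ - 1) * ∑ k, |a k * b k|
        + n * ((1 - F.unitRoundoff) ^ n)⁻¹ * F.underflowUnit := by
  have hκ0 := F.unitRoundoff_pos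
  induction n generalizing t with
  | zero =>
    simp only [subDot, Option.some.injEq] at h
    subst h
    exact ⟨hs, 1, isErrorFactor_zero _, by simp⟩
  | succ n ih =>
    simp only [subDot, hx, hy, Option.bind_eq_bind, Option.bind_some, Option.bind_eq_some_iff,
      mul, sub] at h
    obtain ⟨u, hu, p, hp, ht⟩ := h
    have hp := round_eq_some hp
    have ht := round_eq_some ht
    have hu := by
      refine ih _ _ (fun k => a k.castSucc) (fun k => b k.castSucc) ?_ ?_ (by simpa [hx, hy] using hu)
      · intro k; rfl
      · intro k; rfl
    obtain ⟨hug, φ, hφ, hle⟩ := hu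
    have hpg : p ∈ F.grid := hp ▸ (hfl _).1
    obtain ⟨δ, ε, hδ, hε, hpe⟩ := hfl.exists_error (a (Fin.last n) * b (Fin.last n))
    obtain ⟨δ', hδ', hte⟩ := hfl.exists_error_sub hug hpg
    rw [← hp] at hpe
    rw [← ht] at hte
    have hf' := isErrorFactor_one_add hκ hδ'
    have hne := (hf'.pos hκ).ne'
    refine ⟨ht ▸ (hfl _).1, φ * (1 + δ')⁻¹, hφ.mul hκ (hf'.inv hκ), ?_⟩
    set κ := F.unitRoundoff
    set c := a (Fin.last n) * b (Fin.last n)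
    have hψ := (hφ.mul hκ (isErrorFactor_one_add hκ hδ)).abs_sub_one_le hκ
    have hg : ((1 - κ) ^ n)⁻¹ ≤ ((1 - κ) ^ (n + 1))⁻¹ :=
      inv_anti₀ (pow_pos (by linarith) _)
        (pow_le_pow_of_le_one (by linarith) (by linarith) n.le_succ)
    have hφle : |φ * ε| ≤ ((1 - κ) ^ (n + 1))⁻¹ * F.underflowUnit := by
      rw [abs_mul, abs_of_pos (hφ.pos hκ)]
      exact mul_le_mul (hφ.2.trans hg) hε (abs_nonneg _) (((hφ.pos hκ).le.trans hφ.2).trans hg)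
    rw [Fin.sum_univ_castSucc, Fin.sum_univ_castSucc]
    -- Substitute u = t/(1+δ') + p and p = c(1+δ) + ε.
    have key : s - (∑ k : Fin n, a k.castSucc * b k.castSucc + c) - φ * (1 + δ')⁻¹ * t
        = (s - ∑ k : Fin n, a k.castSucc * b k.castSucc - φ * u) + (φ * (1 + δ) - 1) * c
          + φ * ε := by
      rw [hte, hpe]
      field_simp
      ring
    rw [key]
    set S := ∑ k : Fin n, |a k.castSucc * b k.castSucc| with hS
    have hS0 : 0 ≤ S := Finset.sum_nonneg fun _ _ => abs_nonneg _
    have h3 : |(φ * (1 + δ) - 1) * c| ≤ (((1 - κ) ^ (n + 1))⁻¹ - 1) * |c| := by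
      rw [abs_mul]
      exact mul_le_mul_of_nonneg_right hψ (abs_nonneg _)
    have h4 : (((1 - κ) ^ n)⁻¹ - 1) * S ≤ (((1 - κ) ^ (n + 1))⁻¹ - 1) * S :=
      mul_le_mul_of_nonneg_right (by linarith) hS0
    have h5 : n * ((1 - κ) ^ n)⁻¹ * F.underflowUnit
        ≤ n * ((1 - κ) ^ (n + 1))⁻¹ * F.underflowUnit :=
      mul_le_mul_of_nonneg_right (mul_le_mul_of_nonneg_left hg (Nat.cast_nonneg _))
        F.underflowUnit_pos.le
    refine (abs_add_three _ _ _).trans ?_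
    push_cast
    linarith

/-- Subtracting squares does not increase the value. -/
theorem subDot_self_le (hfl : F.IsRoundToNearest fl) {s : ℝ} (hs : s ∈ F.grid) (n : ℕ)
    (x : Fin n → Option ℝ) {t : ℝ} (h : F.subDot fl s n x x = some t) : t ∈ F.grid ∧ t ≤ s := by
  induction n generalizing t with
  | zero =>
    simp only [subDot, Option.some.injEq] at h
    subst h
    exact ⟨hs, le_rfl⟩
  | succ n ih =>
    simp only [subDot, Option.bind_eq_bind, Option.bind_eq_some_iff, mul, sub] at h
    obtain ⟨u, hu, a, ha, b, hb, p, hp, ht⟩ := h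
    obtain rfl : a = b := Option.some.inj (ha.symm.trans hb)
    have hp := round_eq_some hp
    have ht := round_eq_some ht
    obtain ⟨hug, hus⟩ := ih _ hu
    have hp0 : 0 ≤ p := hp ▸ hfl.le_of_ge F.zero_mem_grid (mul_self_nonneg a)
    exact ⟨ht ▸ (hfl _).1, ht ▸ (hfl.le_of_le hug (by linarith)).trans hus⟩


/-! ### From an entrywise Gram error to semidefiniteness -/

/-- Here xᵀCx ≥ ‖Rx‖² - γ‖|R||x|‖² - w(∑|xᵢ|)². Drop ‖Rx‖² and apply Cauchy–Schwarz to the other two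
terms, bounding them by γ‖R‖_F²‖x‖² and w·card ι·‖x‖². -/
theorem posSemidef_add_smul_one_of_abs_sub_gram_le {ι κ : Type*} [Fintype ι] [DecidableEq ι]
    [Fintype κ] {C : Matrix ι ι ℝ} (hC : C.IsSymm) (R : Matrix κ ι ℝ) {γ w μ : ℝ} (hγ : 0 ≤ γ)
    (hw : 0 ≤ w)
    (h : ∀ i j, |C i j - ∑ k, R k i * R k j| ≤ γ * ∑ k, |R k i * R k j| + w)
    (hμ : γ * ∑ i, ∑ k, R k i ^ 2 + Fintype.card ι * w ≤ μ) :
    (C + μ • (1 : Matrix ι ι ℝ)).PosSemidef := by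
  refine Matrix.PosSemidef.of_dotProduct_mulVec_nonneg ?_ fun x => ?_
  · rw [Matrix.IsHermitian, Matrix.conjTranspose_eq_transpose_of_trivial]
    simp [hC.eq]
  have hN : 0 ≤ ∑ i, x i ^ 2 := Finset.sum_nonneg fun _ _ => sq_nonneg _
  have hquad : star x ⬝ᵥ (C + μ • (1 : Matrix ι ι ℝ)).mulVec x
      = ∑ i, ∑ j, x i * x j * C i j + μ * ∑ i, x i ^ 2 := by
    rw [Matrix.add_mulVec, dotProduct_add, Matrix.smul_mulVec, Matrix.one_mulVec]
    simp only [dotProduct, Matrix.mulVec, star_trivial, Finset.mul_sum, Pi.smul_apply, smul_eq_mul]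
    congr 1
    · exact Finset.sum_congr rfl fun i _ => Finset.sum_congr rfl fun j _ => by ring
    · exact Finset.sum_congr rfl fun i _ => by ring
  have hgram : ∀ (y : ι → ℝ) (S : Matrix κ ι ℝ),
      ∑ i, ∑ j, y i * y j * ∑ k, S k i * S k j = ∑ k, (∑ i, S k i * y i) ^ 2 := by
    intro y S
    simp_rw [sq, Finset.sum_mul_sum, Finset.mul_sum]
    symm
    rw [Finset.sum_comm]
    refine Finset.sum_congr rfl fun i _ => ?_
    rw [Finset.sum_comm]
    exact Finset.sum_congr rfl fun j _ => Finset.sum_congr rfl fun k _ => by ring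
  have hterm : ∀ i j, x i * x j * ∑ k, R k i * R k j
      - |x i| * |x j| * (γ * ∑ k, |R k i| * |R k j| + w) ≤ x i * x j * C i j := by
    intro i j
    have h1 := h i j
    simp only [abs_mul] at h1
    have h2 : |x i * x j * (C i j - ∑ k, R k i * R k j)|
        ≤ |x i| * |x j| * (γ * ∑ k, |R k i| * |R k j| + w) := by
      rw [abs_mul, abs_mul]
      exact mul_le_mul_of_nonneg_left h1 (by positivity)
    have := (abs_le.1 h2).1
    linarith
  have hsum := Finset.sum_le_sum fun i (_ : i ∈ Finset.univ) =>
    Finset.sum_le_sum fun j (_ : j ∈ Finset.univ) => hterm i j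
  have hsplit : ∑ i, ∑ j, |x i| * |x j| * (γ * ∑ k, |R k i| * |R k j| + w)
      = γ * ∑ k, (∑ i, |R k i| * |x i|) ^ 2 + w * (∑ i, |x i|) ^ 2 := by
    rw [← hgram (fun i => |x i|) (fun k i => |R k i|), sq, Finset.sum_mul_sum, Finset.mul_sum,
      Finset.mul_sum, ← Finset.sum_add_distrib]
    refine Finset.sum_congr rfl fun i _ => ?_
    rw [Finset.mul_sum, Finset.mul_sum, ← Finset.sum_add_distrib]
    exact Finset.sum_congr rfl fun j _ => by ring
  simp only [Finset.sum_sub_distrib] at hsum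
  rw [hgram, hsplit] at hsum
  have hcs : ∑ k, (∑ i, |R k i| * |x i|) ^ 2 ≤ (∑ i, ∑ k, R k i ^ 2) * ∑ i, x i ^ 2 := by
    rw [Finset.sum_comm, Finset.sum_mul]
    refine Finset.sum_le_sum fun k _ => ?_
    simpa using Finset.sum_mul_sq_le_sq_mul_sq Finset.univ (fun i => |R k i|) (fun i => |x i|)
  have hcs' : (∑ i, |x i|) ^ 2 ≤ Fintype.card ι * ∑ i, x i ^ 2 := by
    simpa using sq_sum_le_card_mul_sum_sq (s := Finset.univ) (f := fun i => |x i|)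
  have hsq : 0 ≤ ∑ k, (∑ i, R k i * x i) ^ 2 := Finset.sum_nonneg fun _ _ => sq_nonneg _
  rw [hquad]
  have := mul_le_mul_of_nonneg_left hcs hγ
  have := mul_le_mul_of_nonneg_left hcs' hw
  have := mul_le_mul_of_nonneg_right hμ hN
  linarith

/-! ### Backward error of the Cholesky factor -/

theorem sum_fin_eq_sum_lt_add {D : ℕ} (i : Fin D) {f : Fin D → ℝ} (hf : ∀ k, i < k → f k = 0) :
    ∑ k, f k = ∑ k : Fin i.val, f ⟨k.val, k.isLt.trans i.isLt⟩ + f i := by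
  set g : ℕ → ℝ := fun k => if h : k < D then f ⟨k, h⟩ else 0 with hg
  have h1 : ∑ k, f k = ∑ k ∈ Finset.range D, g k := by
    rw [← Fin.sum_univ_eq_sum_range]
    exact Finset.sum_congr rfl fun k _ => by simp [hg]
  have h2 : ∑ k : Fin i.val, f ⟨k.val, k.isLt.trans i.isLt⟩ = ∑ k ∈ Finset.range i, g k := by
    rw [← Fin.sum_univ_eq_sum_range]
    exact Finset.sum_congr rfl fun k _ => by simp [hg, k.isLt.trans i.isLt]
  have h3 : f i = g i := by simp [hg]
  rw [h1, h2, h3, ← Finset.sum_range_succ]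
  symm
  refine Finset.sum_subset (fun k hk => ?_) fun k hk hk' => ?_
  · have := i.isLt
    simp only [Finset.mem_range] at hk ⊢
    omega
  · simp only [Finset.mem_range] at hk hk'
    simp only [hg, hk, dif_pos]
    exact hf _ (Fin.lt_def.2 (by simp only; omega))

/-- The upper triangular factor computed by the Cholesky algorithm. -/
noncomputable def choleskyFactor (F : FloatFormat) (fl : ℝ → ℝ) {D : ℕ}
    (C : Matrix (Fin D) (Fin D) ℝ) : Matrix (Fin D) (Fin D) ℝ :=
  -- When the algorithm succeeds, the default `0` of `getD` is never reached.
  fun i j => if i ≤ j then (F.choleskyEntry fl C i j).getD 0 else 0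

theorem choleskyEntry_eq_some {D : ℕ} {C : Matrix (Fin D) (Fin D) ℝ}
    (h : F.CholeskySucceeds fl C) {i j : Fin D} (hij : i ≤ j) :
    F.choleskyEntry fl C i j = some (F.choleskyFactor fl C i j) := by
  obtain ⟨r, hr⟩ := Option.isSome_iff_exists.1 (h i j hij)
  simp [choleskyFactor, hij, hr]

theorem exists_subDot_of_choleskySucceeds {D : ℕ} {C : Matrix (Fin D) (Fin D) ℝ}
    (h : F.CholeskySucceeds fl C) {i j : Fin D} (hij : i ≤ j) :
    ∃ t, F.subDot fl (C i j) i.val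
        (fun k => F.choleskyEntry fl C ⟨k.val, k.isLt.trans i.isLt⟩ i)
        (fun k => F.choleskyEntry fl C ⟨k.val, k.isLt.trans i.isLt⟩ j) = some t ∧
      (i < j → F.choleskyFactor fl C i i ≠ 0 ∧
        F.choleskyFactor fl C i j = fl (t / F.choleskyFactor fl C i i)) ∧
      (i = j → 0 ≤ t ∧ F.choleskyFactor fl C i j = fl (Real.sqrt t)) := by
  have hr := choleskyEntry_eq_some h hij
  rw [choleskyEntry] at hr
  simp only [Option.bind_eq_bind, Option.bind_eq_some_iff] at hr
  obtain ⟨t, ht, hr⟩ := hr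
  refine ⟨t, ht, fun hlt => ?_, fun heq => ?_⟩
  · rw [if_pos hlt, choleskyEntry_eq_some h le_rfl, Option.bind_some, div] at hr
    split_ifs at hr with hd
    exact ⟨hd, round_eq_some hr⟩
  · rw [if_neg (by simp [heq]), sqrt] at hr
    split_ifs at hr with hd
    exact ⟨not_lt.1 hd, round_eq_some hr⟩

theorem choleskySucceeds_diag_nonneg (hfl : F.IsRoundToNearest fl) {D : ℕ}
    {C : Matrix (Fin D) (Fin D) ℝ} (hC : ∀ i j, C i j ∈ F.grid) (h : F.CholeskySucceeds fl C)
    (i : Fin D) : 0 ≤ C i i := by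
  obtain ⟨t, ht, -, hs⟩ := exists_subDot_of_choleskySucceeds h (le_refl i)
  exact (hs rfl).1.trans (subDot_self_le hfl (hC i i) _ _ ht).2

/-- Backward error of one entry of the factor, in terms of `g = (1 - κ)⁻⁽ᴰ⁺¹⁾`. -/
theorem cholesky_backward_error (hfl : F.IsRoundToNearest fl) (hκ : F.unitRoundoff < 1) {D : ℕ}
    {C : Matrix (Fin D) (Fin D) ℝ} (hC : ∀ i j, C i j ∈ F.grid) (h : F.CholeskySucceeds fl C)
    {i j : Fin D} (hij : i ≤ j) {g : ℝ} (hg : g = ((1 - F.unitRoundoff) ^ (D + 1))⁻¹) :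
    |C i j - ∑ k, F.choleskyFactor fl C k i * F.choleskyFactor fl C k j|
      ≤ (g - 1) * ∑ k, |F.choleskyFactor fl C k i * F.choleskyFactor fl C k j|
        + g * F.underflowUnit * (D + 2 * |F.choleskyFactor fl C i i| + F.underflowUnit) := by
  have hκ0 := F.unitRoundoff_pos
  have hη := F.underflowUnit_pos
  set R := F.choleskyFactor fl C with hR
  have hlow : ∀ k, i < k → R k i = 0 := fun k hk => by simp [hR, choleskyFactor, hk.not_ge]
  rw [sum_fin_eq_sum_lt_add i (fun k hk => by rw [hlow k hk, zero_mul]),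
    sum_fin_eq_sum_lt_add i (fun k hk => by rw [hlow k hk, zero_mul, abs_zero])]
  obtain ⟨t, ht, hlt, heq⟩ := exists_subDot_of_choleskySucceeds h hij
  rw [← hR] at hlt heq
  obtain ⟨-, φ, hφ, hle⟩ := subDot_backward_error hfl hκ (hC i j) i.val _ _
    (fun k => R ⟨k.val, k.isLt.trans i.isLt⟩ i) (fun k => R ⟨k.val, k.isLt.trans i.isLt⟩ j)
    (fun k => choleskyEntry_eq_some h (Fin.le_def.2 k.isLt.le))
    (fun k => choleskyEntry_eq_some h ((Fin.le_def.2 k.isLt.le).trans hij)) ht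
  set κ := F.unitRoundoff
  set η := F.underflowUnit
  set S := ∑ k : Fin i.val,
    |R ⟨k.val, k.isLt.trans i.isLt⟩ i * R ⟨k.val, k.isLt.trans i.isLt⟩ j|
  set T := ∑ k : Fin i.val, R ⟨k.val, k.isLt.trans i.isLt⟩ i * R ⟨k.val, k.isLt.trans i.isLt⟩ j
  have hS0 : 0 ≤ S := Finset.sum_nonneg fun _ _ => abs_nonneg _
  have hiD : (i.val : ℝ) ≤ D := by exact_mod_cast i.isLt.le
  have hginv : ((1 - κ) ^ i.val)⁻¹ ≤ g := by
    rw [hg]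
    exact inv_anti₀ (pow_pos (by linarith) _)
      (pow_le_pow_of_le_one (by linarith) (by linarith) (by have := i.isLt; omega))
  have hg1 : 0 < ((1 - κ) ^ i.val)⁻¹ := inv_pos.2 (pow_pos (by linarith) _)
  have hbase : |C i j - T - φ * t| ≤ (g - 1) * S + D * g * η := by
    refine hle.trans (add_le_add (mul_le_mul_of_nonneg_right (by linarith) hS0)
      (mul_le_mul_of_nonneg_right (mul_le_mul hiD hginv hg1.le (Nat.cast_nonneg _)) hη.le))
  have hlast : |φ * t - R i i * R i j|
      ≤ (g - 1) * |R i i * R i j| + g * η * (2 * |R i i| + η) := by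
    -- The inner product contributes i ≤ D - 1 factors, a division one more and a square root two
    -- more because it gets squared: at most D + 1.
    have hfac : ∀ n ≤ D + 1, ∀ ψ, IsErrorFactor κ n ψ → |ψ - 1| ≤ g - 1 ∧ |ψ| ≤ g := by
      intro n hn ψ hψ
      have hψ' := hψ.mono hκ0.le hκ hn
      rw [hg, abs_of_pos (hψ.pos hκ)]
      exact ⟨hψ'.abs_sub_one_le hκ, hψ'.2⟩
    rcases hij.lt_or_eq with hl | rfl
    · obtain ⟨hd, hr⟩ := hlt hl
      obtain ⟨δ, ε, hδ, hε, he⟩ := hfl.exists_error (t / R i i)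
      have hf := isErrorFactor_one_add hκ hδ
      have hne := (hf.pos hκ).ne'
      obtain ⟨hψ1, hψ2⟩ := hfac _ (by have := i.isLt; omega) _ (hφ.mul hκ (hf.inv hκ))
      set ψ := φ * (1 + δ)⁻¹ with hψ
      have hkey : φ * t - R i i * R i j = (ψ - 1) * (R i i * R i j) - ψ * (ε * R i i) := by
        rw [hr, he, hψ]
        field_simp
        ring
      rw [hkey]
      refine (abs_sub _ _).trans ?_
      have h1 := mul_le_mul_of_nonneg_right hψ1 (abs_nonneg (R i i * R i j))
      have h2 : |ψ| * (|ε| * |R i i|) ≤ g * (η * |R i i|) :=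
        mul_le_mul hψ2 (mul_le_mul_of_nonneg_right hε (abs_nonneg _)) (by positivity)
          ((abs_nonneg _).trans hψ2)
      have h3 : 0 ≤ g * η * (|R i i| + η) :=
        mul_nonneg (mul_nonneg (hg1.le.trans hginv) hη.le) (by positivity)
      rw [abs_mul, abs_mul ψ, abs_mul ε]
      linarith
    · obtain ⟨ht0, hr⟩ := heq rfl
      obtain ⟨δ, ε, hδ, hε, he⟩ := hfl.exists_error (Real.sqrt t)
      have hf := isErrorFactor_one_add hκ hδ
      have hne := (hf.pos hκ).ne'
      obtain ⟨hψ1, hψ2⟩ := hfac _ (by have := i.isLt; omega) _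
        ((hφ.mul hκ (hf.inv hκ)).mul hκ (hf.inv hκ))
      set ψ := φ * (1 + δ)⁻¹ * (1 + δ)⁻¹ with hψ
      have hkey : φ * t - R i i * R i i
          = (ψ - 1) * (R i i * R i i) + ψ * (ε * (ε - 2 * R i i)) := by
        have hs : Real.sqrt t = (R i i - ε) * (1 + δ)⁻¹ := by
          rw [hr, he]
          field_simp
          ring
        have hts : φ * t = ψ * (R i i - ε) ^ 2 := by
          conv_lhs => rw [← Real.sq_sqrt ht0, hs]
          rw [hψ]
          ring
        rw [hts]
        ring
      rw [hkey]
      refine (abs_add_le _ _).trans ?_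
      have h1 := mul_le_mul_of_nonneg_right hψ1 (abs_nonneg (R i i * R i i))
      have h0 : |ε - 2 * R i i| ≤ 2 * |R i i| + η := by
        refine (abs_sub _ _).trans ?_
        rw [abs_mul, abs_two]
        linarith
      have h2 : |ψ| * (|ε| * |ε - 2 * R i i|) ≤ g * (η * (2 * |R i i| + η)) :=
        mul_le_mul hψ2 (mul_le_mul hε h0 (abs_nonneg _) hη.le) (by positivity)
          ((abs_nonneg _).trans hψ2)
      rw [abs_mul, abs_mul ψ, abs_mul ε]
      linarith
  have hsplit : C i j - (T + R i i * R i j) = (C i j - T - φ * t) + (φ * t - R i i * R i j) := by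
    ring
  rw [hsplit]
  refine (abs_add_le _ _).trans ?_
  linarith


/-- Bernoulli's inequality, (1-κ)^n ≥ 1 - nκ. -/
theorem inv_one_sub_pow_le {κ : ℝ} (hκ : κ < 1) (n : ℕ) :
    ((1 - κ) ^ n)⁻¹ * (1 - n * κ) ≤ 1 := by
  have hb := one_add_mul_le_pow (a := -κ) (by linarith) n
  rw [← sub_eq_add_neg] at hb
  have hp : 0 < (1 - κ) ^ n := pow_pos (by linarith) n
  rw [inv_mul_le_iff₀ hp]
  linarith

end FloatFormat

theorem mainTheorem11 (F : FloatFormat) (fl : ℝ → ℝ) (hfl : F.IsRoundToNearest fl)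
    (D : ℕ) (C : Matrix (Fin D) (Fin D) ℝ)
    (hC : ∀ i j, C i j ∈ F.numbers) (hsymm : C.IsSymm)
    (hden : 0 < 1 - (2 * (D : ℝ) + 2) * F.unitRoundoff)
    (hsmall : ((D : ℝ) + 1) * D * F.unitRoundoff / (1 - (2 * (D : ℝ) + 2) * F.unitRoundoff)
      + 4 * ((D : ℝ) + 1) * F.underflowUnit ≤ 1 / 2)
    (β : ℝ)
    (hβ : β = ((D : ℝ) + 1) * F.unitRoundoff / (1 - (2 * (D : ℝ) + 2) * F.unitRoundoff) * C.trace
      + 4 * ((D : ℝ) + 1) * (2 * ((D : ℝ) + 2) + ⨆ i, C i i) * F.underflowUnit)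
    (hβpos : 0 < β)
    (hchol : F.CholeskySucceeds fl C) :
    (C + (2 * β) • (1 : Matrix (Fin D) (Fin D) ℝ)).PosSemidef := by
  rcases Nat.eq_zero_or_pos D with rfl | hDpos
  · rw [Subsingleton.elim (C + (2 * β) • (1 : Matrix (Fin 0) (Fin 0) ℝ)) 0]
    exact Matrix.PosSemidef.zero
  have hD1 : (1 : ℝ) ≤ D := by exact_mod_cast hDpos
  have hκ0 := F.unitRoundoff_pos
  have hη := F.underflowUnit_pos
  have hgrid : ∀ i j, C i j ∈ F.grid := fun i j => F.numbers_subset_grid (hC i j)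
  have hκ : F.unitRoundoff < 1 := by nlinarith
  have hback := fun (i j : Fin D) (hij : i ≤ j) =>
    FloatFormat.cholesky_backward_error hfl hκ hgrid hchol hij rfl
  have hdiag := FloatFormat.choleskySucceeds_diag_nonneg hfl hgrid hchol
  have hM : ∀ i, C i i ≤ ⨆ i, C i i := fun i => le_ciSup (f := fun i => C i i)
    (Set.finite_range _).bddAbove i
  have hM0 : 0 ≤ ⨆ i, C i i := (hdiag ⟨0, hDpos⟩).trans (hM _)
  set κ := F.unitRoundoff
  set η := F.underflowUnit
  set M := ⨆ i, C i i
  set R := F.choleskyFactor fl C with hR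
  have hgle := FloatFormat.inv_one_sub_pow_le hκ (D + 1)
  have hg1 : 1 ≤ ((1 - κ) ^ (D + 1))⁻¹ :=
    (one_le_inv₀ (pow_pos (by linarith) _)).2 (pow_le_one₀ (by linarith) (by linarith))
  set g := ((1 - κ) ^ (D + 1))⁻¹ with hg
  push_cast at hgle
  set a := ((D : ℝ) + 1) * κ / (1 - (2 * (D : ℝ) + 2) * κ) with ha
  have ha0 : 0 < a := div_pos (by positivity) hden
  have hDa : D * a + 4 * ((D : ℝ) + 1) * η ≤ 1 / 2 := by
    rw [ha]
    convert hsmall using 2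
    ring
  -- After clearing the denominator this is g(1 - (D+1)κ) ≤ 1; the doubled 2D + 2 in `a` pays for
  -- the factor 1 - γ, where γ = g - 1.
  have hga : g - 1 ≤ a * (1 - (g - 1)) := by
    rw [ha, div_mul_eq_mul_div, le_div_iff₀ hden]
    linarith
  have hη' : ((D : ℝ) + 1) * η ≤ 1 / 8 := by nlinarith
  have hη16 : η ≤ 1 / 16 := by nlinarith
  have ha2 : a ≤ 1 / 2 := by nlinarith
  have hg3 : g - 1 ≤ 1 / 3 := by nlinarith
  have hDa2 : D * a ≤ 1 / 2 := by nlinarith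
  set N : Fin D → ℝ := fun i => ∑ k, R k i ^ 2 with hN
  have hN0 : ∀ i, 0 ≤ N i := fun i => Finset.sum_nonneg fun _ _ => sq_nonneg _
  have hRN : ∀ i, 2 * |R i i| ≤ 1 + N i := by
    intro i
    have h1 : R i i ^ 2 ≤ N i :=
      Finset.single_le_sum (f := fun k => R k i ^ 2) (fun _ _ => sq_nonneg _) (Finset.mem_univ i)
    nlinarith [sq_abs (R i i), sq_nonneg (|R i i| - 1)]
  have hw : ∀ i, g * η * (D + 2 * |R i i| + η) ≤ 2 * η * (D + 17 / 16 + N i) := by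
    intro i
    have := hN0 i
    have h1 : (D : ℝ) + 2 * |R i i| + η ≤ D + 17 / 16 + N i := by linarith [hRN i]
    exact mul_le_mul (mul_le_mul_of_nonneg_right (by linarith) hη.le) h1 (by positivity)
      (by positivity)
  have hNdiag : ∀ i, N i * (1 - (g - 1)) ≤ C i i + g * η * (D + 2 * |R i i| + η) := by
    intro i
    have h1 := (abs_le.1 (hback i i le_rfl)).1
    simp only [abs_mul_self] at h1
    simp only [← sq] at h1
    change _ ≤ C i i - N i at h1
    change -((g - 1) * N i + _) ≤ _ at h1
    linarith
  -- The underflow term itself contains N i, but with coefficient 2η ≤ 1/8, so it is absorbed on the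
  -- left, where N i has coefficient 2/3.
  have hNM : ∀ i, N i ≤ 2 * M + 1 / 2 := by
    intro i
    have h1 := hNdiag i
    have h2 := hw i
    have h3 := hM i
    have h4 := hN0 i
    have h5 : N i * (2 / 3) ≤ N i * (1 - (g - 1)) := mul_le_mul_of_nonneg_left (by linarith) h4
    have h6 : η * N i ≤ 1 / 16 * N i := mul_le_mul_of_nonneg_right hη16 h4
    linarith
  set W := 2 * η * (D + 2 + 2 * M) with hWdef
  have hW0 : 0 ≤ W := by positivity
  have hwW : ∀ i, g * η * (D + 2 * |R i i| + η) ≤ W := fun i =>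
    (hw i).trans (mul_le_mul_of_nonneg_left (by linarith [hNM i]) (by positivity))
  have hall : ∀ i j, |C i j - ∑ k, R k i * R k j| ≤ (g - 1) * ∑ k, |R k i * R k j| + W := by
    intro i j
    rcases le_total i j with hij | hij
    · exact (hback i j hij).trans (by linarith [hwW i])
    · have h1 := (hback j i hij).trans (add_le_add_right (hwW j) _)
      rw [hsymm.apply] at h1
      simpa only [mul_comm (R _ j)] using h1
  refine FloatFormat.posSemidef_add_smul_one_of_abs_sub_gram_le hsymm R (by linarith) hW0 hall ?_
  have hsum : (1 - (g - 1)) * ∑ i, N i ≤ C.trace + D * W := by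
    rw [Finset.mul_sum]
    calc ∑ i, (1 - (g - 1)) * N i ≤ ∑ i, (C i i + W) :=
          Finset.sum_le_sum fun i _ => by linarith [hNdiag i, hwW i]
      _ = C.trace + D * W := by simp [Finset.sum_add_distrib, Matrix.trace]
  have hNs : 0 ≤ ∑ i, N i := Finset.sum_nonneg fun i _ => hN0 i
  have h1 : (g - 1) * ∑ i, N i ≤ a * (C.trace + D * W) :=
    (mul_le_mul_of_nonneg_right hga hNs).trans
      (by rw [mul_assoc]; exact mul_le_mul_of_nonneg_left hsum ha0.le)
  have h2 : D * a * W ≤ 1 / 2 * W := mul_le_mul_of_nonneg_right hDa2 hW0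
  have h3 : (D + 1 / 2) * W ≤ 4 * ((D : ℝ) + 1) * (2 * ((D : ℝ) + 2) + M) * η := by
    have h4 : ((D : ℝ) + 1 / 2) * (2 * (D + 2 + 2 * M))
        ≤ (D + 1) * (4 * (2 * ((D : ℝ) + 2) + M)) :=
      mul_le_mul (by linarith) (by linarith) (by positivity) (by positivity)
    have := mul_le_mul_of_nonneg_right h4 hη.le
    rw [hWdef]
    linarith
  rw [Fintype.card_fin]
  change (g - 1) * ∑ i, N i + D * W ≤ _
  -- The loss is at most a·tr C + (D + 1/2)W ≤ β, and β ≤ 2β by positivity.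
  linarith
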